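/- Let $p\in\mathbb{N}$ (the case $p=0$, where the sphere is empty, is allowed and trivial), and let $\mu,\nu$ be Borel probability measures on $\mathbb{R}^p$ with compact supports. For $\theta$ in the Euclidean unit sphere $\mathbf{S}^{p-1}$ let $P_\theta(x)=\langle x,\theta\rangle$, and write $P_\theta\#\mu$ for the push-forward of $\mu$ by $P_\theta$. Suppose that for almost every $\theta\in\mathbf{S}^{p-1}$ (with respect to the uniform measure on the sphere) the measures $P_\theta\#\mu$ and $P_\theta\#\nu$ are isomorphic, that is, there exists a surjective measurable map $T_\theta:\operatorname{supp}(P_\theta\#\mu)\to\operatorname{supp}(P_\theta\#\nu)$ such that $$T_\theta\#(P_\theta\#\mu)=P_\theta\#\nu\quad\text{and}\quad |T_\theta(s)-T_\theta(s')|=|s-s'|\ \text{ for all } s,s'\in\operatorname{supp}(P_\theta\#\mu).$$ Then $\mu$ and $\nu$ are isomorphic for the distance induced by the $\ell_1$ norm: there exists a surjective measurable map $f:\operatorname{supp}(\mu)\to\operatorname{supp}(\nu)$ such that $$f\#\mu=\nu\quad\text{and}\quad \|f(x)-f(x')\|_1=\|x-x'\|_1\ \text{ for all } x,x'\in\operatorname{supp}(\mu),$$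 where $\|x\|_1=\sum_{i=1}^p|x_i|$. -/

import Mathlib

open MeasureTheory

/-- The distance on `ℝ^p` induced by the `ℓ¹` norm. -/
def distL1 {p : ℕ} (x y : EuclideanSpace ℝ (Fin p)) : ℝ :=
  ∑ i, |x i - y i|

/-- `f : supp μ → supp ν` is an isomorphism of metric measure spaces for the distances `dX`
and `dY`: it is surjective, pushes `μ` (which is carried by its support) forward to `ν`, and
preserves distances. -/
structure IsMMIso {X Y : Type*} [TopologicalSpace X] [MeasurableSpace X]
    [TopologicalSpace Y] [MeasurableSpace Y] (dX : X → X → ℝ) (dY : Y → Y → ℝ)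
    (μ : Measure X) (ν : Measure Y) (f : μ.support → ν.support) : Prop where
  surjective : Function.Surjective f
  measurable : Measurable f
  map_eq : (μ.comap (Subtype.val : μ.support → X)).map (fun x => (f x : Y)) = ν
  dist_eq : ∀ x x' : μ.support, dY (f x) (f x') = dX x x'

/-- `(supp μ, dX, μ)` and `(supp ν, dY, ν)` are isomorphic. -/
def MMIsomorphic {X Y : Type*} [TopologicalSpace X] [MeasurableSpace X]
    [TopologicalSpace Y] [MeasurableSpace Y] (dX : X → X → ℝ) (dY : Y → Y → ℝ)
    (μ : Measure X) (ν : Measure Y) : Prop :=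
  ∃ f : μ.support → ν.support, IsMMIso dX dY μ ν f

/-- The projection `P_θ x = ⟨x, θ⟩` on the line directed by the unit vector `θ`. -/
noncomputable def projDir {p : ℕ} (θ : Metric.sphere (0 : EuclideanSpace ℝ (Fin p)) 1)
    (x : EuclideanSpace ℝ (Fin p)) : ℝ :=
  inner ℝ x (θ : EuclideanSpace ℝ (Fin p))

/-!
The measure `ν` turns out to be the image of `μ` under a map `x ↦ ε x + c` with a single sign
`ε = ±1`, and such a map is an isometry for the `ℓ¹` distance.

For almost every direction `θ`, a distance-preserving map between subsets of the line is a
translation or a reflection (`exists_affine_of_abs_sub_eq`), so the projection of `ν` on `θ` is the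
image of that of `μ` under some `s ↦ ε(θ) s + c(θ)`. Comparing means determines `c(θ)`: once `μ` and
`ν` are translated to have barycenter `0`, their characteristic functions satisfy
`φ_ν (t θ) = φ_μ (ε(θ) t θ)` for all `t` (`centredCharFun_smul_of_map_affine`).

It remains to choose the sign independently of `θ`. The product
`(φ_ν ξ - φ_μ ξ) (φ_ν ξ - φ_μ (-ξ))` vanishes for almost every direction of `ξ`, hence everywhere
because it is continuous. The supports are compact, so both factors are real-analytic along every
line (`analyticOnNhd_charFun_lineMap`); a product of two such functions vanishes identically only
if one of them does (`forall_eq_zero_or_forall_eq_zero_of_mul_eq_zero`). Hence `φ_ν` is `φ_μ` or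
`φ_μ (-·)`, and characteristic functions determine measures.
-/

/-! ### Isometries between supports on the line -/

/-- A distance-preserving real function on a subset of the line is a translation or a reflection,
with no assumption on the subset. -/
theorem exists_affine_of_abs_sub_eq {S : Set ℝ} {T : S → ℝ}
    (hT : ∀ s s' : S, |T s - T s'| = |(s : ℝ) - s'|) :
    ∃ ε c : ℝ, (ε = 1 ∨ ε = -1) ∧ ∀ s : S, T s = ε * s + c := by
  by_cases hS : S.Subsingleton
  · rcases S.eq_empty_or_nonempty with rfl | ⟨s₀, hs₀⟩
    · exact ⟨1, 0, .inl rfl, fun s => s.2.elim⟩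
    · refine ⟨1, T ⟨s₀, hs₀⟩ - s₀, .inl rfl, fun s => ?_⟩
      obtain rfl : s = ⟨s₀, hs₀⟩ := Subtype.ext (hS s.2 hs₀)
      ring
  · obtain ⟨a, ha, b, hb, hab⟩ := Set.not_subsingleton_iff.1 hS
    obtain ⟨ε, hε, hεT⟩ : ∃ ε : ℝ, (ε = 1 ∨ ε = -1) ∧
        T ⟨b, hb⟩ - T ⟨a, ha⟩ = ε * (b - a) := by
      rcases abs_eq_abs.1 (hT ⟨b, hb⟩ ⟨a, ha⟩) with h | h
      · exact ⟨1, .inl rfl, by simpa using h⟩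
      · exact ⟨-1, .inr rfl, by simpa using h⟩
    refine ⟨ε, T ⟨a, ha⟩ - ε * a, hε, fun s => ?_⟩
    have h₁ := hT s ⟨a, ha⟩
    have h₂ := hT s ⟨b, hb⟩
    simp only at h₁ h₂
    have hab' : b - a ≠ 0 := sub_ne_zero.2 (Ne.symm hab)
    have hsq : ε * ε = 1 := by rcases hε with rfl | rfl <;> norm_num
    -- The squared distances from `s` to `a` and to `b` determine `T s`.
    have e₁ := sq_eq_sq_iff_abs_eq_abs _ _ |>.2 h₁
    have e₂ := sq_eq_sq_iff_abs_eq_abs _ _ |>.2 h₂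
    -- `(ε (b - a))² = (b - a)²`, so the difference of `e₁` and `e₂` is linear in `T s`.
    have key : 2 * (b - a) * ε * (T s - (ε * s + (T ⟨a, ha⟩ - ε * a))) = 0 := by
      have hTb : T ⟨b, hb⟩ = T ⟨a, ha⟩ + ε * (b - a) := by linarith
      rw [hTb] at e₂
      linear_combination e₁ - e₂ + (2 * (b - a) * (a - (s : ℝ)) + (b - a) ^ 2) * hsq
    have hε0 : ε ≠ 0 := by rintro rfl; simp at hsq
    have := (mul_eq_zero.1 key).resolve_left (by positivity)
    linarith

/-- Pushing forward from the subtype `supp μ` loses no mass, because `μ` is carried by its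
support. -/
theorem MeasureTheory.Measure.map_comap_support {X Y : Type*} [TopologicalSpace X]
    [HereditarilyLindelofSpace X]
    [MeasurableSpace X] [OpensMeasurableSpace X] [MeasurableSpace Y] (μ : Measure X)
    {g : X → Y} (hg : Measurable g) :
    (μ.comap (Subtype.val : μ.support → X)).map (fun x : μ.support => g x) = μ.map g := by
  have hmeas : MeasurableSet μ.support := Measure.isClosed_support.measurableSet
  have : (fun x : μ.support => g x) = g ∘ Subtype.val := rfl
  rw [this, ← Measure.map_map hg measurable_subtype_coe, map_comap_subtype_coe hmeas,
    Measure.restrict_eq_self_of_ae_mem (s := μ.support) Measure.support_mem_ae]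

theorem MMIsomorphic.exists_map_affine {ρ σ : Measure ℝ}
    (h : MMIsomorphic (fun s t : ℝ => |s - t|) (fun s t : ℝ => |s - t|) ρ σ) :
    ∃ ε c : ℝ, (ε = 1 ∨ ε = -1) ∧ σ = ρ.map (fun s => ε * s + c) := by
  obtain ⟨T, hT⟩ := h
  obtain ⟨ε, c, hε, hTε⟩ := exists_affine_of_abs_sub_eq (T := fun s => (T s : ℝ)) hT.dist_eq
  refine ⟨ε, c, hε, ?_⟩
  rw [← hT.map_eq, ← ρ.map_comap_support (g := fun s => ε * s + c) (by fun_prop)]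
  simp only [hTε]

/-! ### Centred characteristic functions -/

section charFun

variable {E : Type*} [NormedAddCommGroup E] [InnerProductSpace ℝ E] [MeasurableSpace E]
  [BorelSpace E]

/-- The characteristic function of `μ` translated so that its barycenter is `0`. If the identity is
not `μ`-integrable, the Bochner integral below is `0` and no translation takes place. -/
noncomputable def centredCharFun (μ : Measure E) (ξ : E) : ℂ :=
  charFun (μ.map (fun x => x - ∫ y, y ∂μ)) ξ

theorem centredCharFun_apply [SecondCountableTopology E] (μ : Measure E) (ξ : E) :
    centredCharFun μ ξ =
      ∫ x, Complex.exp (((inner ℝ x ξ - inner ℝ (∫ y, y ∂μ) ξ : ℝ) : ℂ) * Complex.I) ∂μ := by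
  rw [centredCharFun, charFun_apply, integral_map (by fun_prop)]
  · simp only [inner_sub_left]
  · exact (by fun_prop : Continuous fun x : E =>
      Complex.exp (((inner ℝ x ξ : ℝ) : ℂ) * Complex.I)).aestronglyMeasurable

/-- The constant `c` plays no role after centring: it is determined by the two barycenters. -/
theorem centredCharFun_smul_of_map_affine [SecondCountableTopology E] [CompleteSpace E]
    {μ ν : Measure E} [IsProbabilityMeasure μ]
    (hμ : Integrable (fun x => x) μ) (hν : Integrable (fun x => x) ν) {θ : E} {ε c : ℝ}
    (h : ν.map (fun x => inner ℝ x θ) = (μ.map (fun x => inner ℝ x θ)).map (fun s => ε * s + c))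
    (t : ℝ) : centredCharFun ν (t • θ) = centredCharFun μ ((ε * t) • θ) := by
  have hθ : Continuous fun x : E => (inner ℝ x θ : ℝ) := by fun_prop
  -- Every integral of a function of `⟨x, θ⟩` against `ν` is one against `μ`.
  have change {F : Type} [NormedAddCommGroup F] [NormedSpace ℝ F] {g : ℝ → F}
      (hg : Continuous g) (hg' : StronglyMeasurable g) :
      ∫ x, g (inner ℝ x θ) ∂ν = ∫ x, g (ε * inner ℝ x θ + c) ∂μ := by
    rw [← integral_map (φ := fun x => inner ℝ x θ) (f := g) hθ.aemeasurable
      hg'.aestronglyMeasurable, h, Measure.map_map (by fun_prop) hθ.measurable,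
      integral_map (by fun_prop) hg'.aestronglyMeasurable]
    rfl
  have hmean (ρ : Measure E) (hρ : Integrable (fun x => x) ρ) :
      ∫ x, (inner ℝ x θ : ℝ) ∂ρ = inner ℝ (∫ x, x ∂ρ) θ := by
    simp only [real_inner_comm θ]
    exact integral_inner hρ θ
  have hc : (inner ℝ (∫ x, x ∂ν) θ : ℝ) = ε * inner ℝ (∫ x, x ∂μ) θ + c := by
    rw [← hmean ν hν, ← hmean μ hμ, change continuous_id' stronglyMeasurable_id,
      integral_add ((hμ.inner_const θ).const_mul ε) (integrable_const c), integral_const_mul]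
    simp
  rw [centredCharFun_apply, centredCharFun_apply]
  simp only [inner_smul_right]
  have hg : Continuous fun s : ℝ =>
      Complex.exp (((t * s - t * inner ℝ (∫ y, y ∂ν) θ : ℝ) : ℂ) * Complex.I) := by fun_prop
  rw [change hg hg.stronglyMeasurable, hc]
  congr! 5
  ring

/-- Along a line, the characteristic function of a measure carried by a ball extends to the entire
function `z ↦ ∫ exp (i (⟪x, a⟫ + z ⟪x, v⟫)) dμ`. -/
theorem analyticOnNhd_charFun_lineMap {μ : Measure E} [IsFiniteMeasure μ]
    [SecondCountableTopology E] {R : ℝ} (hR : ∀ᵐ x ∂μ, ‖x‖ ≤ R) (a v : E) :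
    AnalyticOnNhd ℝ (fun t : ℝ => charFun μ (a + t • v)) Set.univ := by
  let F : ℂ → E → ℂ := fun z x =>
    Complex.exp ((((inner ℝ x a : ℝ) : ℂ) + z * ((inner ℝ x v : ℝ) : ℂ)) * Complex.I)
  let F' : ℂ → E → ℂ := fun z x => F z x * (((inner ℝ x v : ℝ) : ℂ) * Complex.I)
  have hF (z : ℂ) : Continuous (F z) := by fun_prop
  have hF' (z : ℂ) : Continuous (F' z) := by fun_prop
  have hv : ∀ᵐ x ∂μ, |(inner ℝ x v : ℝ)| ≤ R * ‖v‖ := by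
    filter_upwards [hR] with x hx
    exact (abs_real_inner_le_norm x v).trans (by gcongr)
  have hbound : ∀ᵐ x ∂μ, ∀ (z : ℂ) (r : ℝ), ‖z‖ ≤ r → ‖F z x‖ ≤ Real.exp (r * (R * ‖v‖)) := by
    filter_upwards [hv] with x hx z r hz
    rw [Complex.norm_exp, Real.exp_le_exp]
    have : ((((inner ℝ x a : ℝ) : ℂ) + z * ((inner ℝ x v : ℝ) : ℂ)) * Complex.I).re
        = - (z.im * inner ℝ x v) := by simp
    rw [this]
    calc - (z.im * inner ℝ x v) ≤ |z.im| * |(inner ℝ x v : ℝ)| := by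
          rw [← abs_mul]; exact neg_le_abs _
      _ ≤ r * (R * ‖v‖) := by
          gcongr
          · exact (norm_nonneg z).trans hz
          · exact (Complex.abs_im_le_norm z).trans hz
  have hdiff : Differentiable ℂ fun z => ∫ x, F z x ∂μ := by
    intro z
    refine (hasDerivAt_integral_of_dominated_loc_of_deriv_le (F := F) (F' := F')
      (bound := fun _ => Real.exp ((‖z‖ + 1) * (R * ‖v‖)) * (R * ‖v‖))
      (Metric.ball_mem_nhds z one_pos) (.of_forall fun w => (hF w).aestronglyMeasurable)
      (.of_bound (hF z).aestronglyMeasurable _ (hbound.mono fun x hx => hx z _ le_rfl))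
      (hF' z).aestronglyMeasurable
      ?_ (integrable_const _) (.of_forall fun x w _ => ?_)).2.differentiableAt
    · filter_upwards [hv, hbound] with x hx hxF w hw
      have hw' : ‖w‖ ≤ ‖z‖ + 1 := by
        have h1 := norm_le_norm_add_norm_sub z w
        rw [mem_ball_iff_norm] at hw
        rw [norm_sub_rev] at h1
        linarith
      have hFw := hxF w _ hw'
      simp only [F', norm_mul, Complex.norm_I, mul_one, Complex.norm_real, Real.norm_eq_abs]
      gcongr
    · have := ((((hasDerivAt_id w).mul_const ((inner ℝ x v : ℝ) : ℂ)).const_add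
        ((inner ℝ x a : ℝ) : ℂ)).mul_const Complex.I).cexp
      simpa [F, F'] using this
  intro t _
  have h1 := (hdiff.analyticAt (t : ℂ)).restrictScalars (𝕜 := ℝ)
  have h2 : AnalyticAt ℝ (fun s : ℝ => (s : ℂ)) t := Complex.ofRealCLM.analyticAt t
  have h3 := AnalyticAt.fun_comp (f := fun s : ℝ => (s : ℂ)) h1 h2
  refine h3.congr (.of_forall fun s => ?_)
  simp [charFun_apply, F, inner_add_right, inner_smul_right]

/-- Real-analyticity along lines replaces analyticity on `E`: if `F a ≠ 0` and `G b ≠ 0`, then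
one of `F`, `G` already vanishes identically on the line through `a` and `b`. -/
theorem forall_eq_zero_or_forall_eq_zero_of_mul_eq_zero {E : Type*} [AddCommGroup E] [Module ℝ E]
    {F G : E → ℂ}
    (hF : ∀ a v : E, AnalyticOnNhd ℝ (fun t : ℝ => F (a + t • v)) Set.univ)
    (hG : ∀ a v : E, AnalyticOnNhd ℝ (fun t : ℝ => G (a + t • v)) Set.univ)
    (h : ∀ x, F x * G x = 0) : (∀ x, F x = 0) ∨ ∀ x, G x = 0 := by
  by_contra! hne
  obtain ⟨⟨a, ha⟩, b, hb⟩ := hne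
  rcases (hF a (b - a)).eq_zero_or_eq_zero_of_mul_eq_zero (hG a (b - a)) (fun t _ => h _)
    isPreconnected_univ with h0 | h0
  · exact ha (by simpa using h0 0 trivial)
  · exact hb (by simpa using h0 1 trivial)

theorem analyticOnNhd_centredCharFun_lineMap {μ : Measure E} [IsFiniteMeasure μ]
    [SecondCountableTopology E] {R : ℝ} (hR : ∀ᵐ x ∂μ, ‖x‖ ≤ R) (a v : E) :
    AnalyticOnNhd ℝ (fun t : ℝ => centredCharFun μ (a + t • v)) Set.univ := by
  refine analyticOnNhd_charFun_lineMap (R := R + ‖∫ y, y ∂μ‖) ?_ a v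
  refine (ae_map_iff (by fun_prop) (measurableSet_le (by fun_prop) (by fun_prop))).2 ?_
  filter_upwards [hR] with x hx
  exact (norm_sub_le _ _).trans (by gcongr)

/-- The sign `ε` may depend on the direction `θ`. Nevertheless the product
`(φ_ν ξ - φ_μ ξ) * (φ_ν ξ - φ_μ (-ξ))` of centred characteristic functions vanishes for almost
every direction of `ξ` (for the measure `τ` on the unit sphere), hence everywhere by continuity, and
analyticity makes one factor vanish. -/
theorem centredCharFun_eq_or_eq_neg [FiniteDimensional ℝ E] {μ ν : Measure E}
    [IsProbabilityMeasure μ] [IsProbabilityMeasure ν] {R : ℝ} (hμ : ∀ᵐ x ∂μ, ‖x‖ ≤ R)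
    (hν : ∀ᵐ x ∂ν, ‖x‖ ≤ R)
    {τ : Measure (Metric.sphere (0 : E) 1)} [τ.IsOpenPosMeasure]
    (h : ∀ᵐ θ : Metric.sphere (0 : E) 1 ∂τ, ∃ ε c : ℝ, (ε = 1 ∨ ε = -1) ∧
      ν.map (fun x => inner ℝ x (θ : E)) =
        (μ.map (fun x => inner ℝ x (θ : E))).map (fun s => ε * s + c)) :
    (∀ ξ, centredCharFun ν ξ = centredCharFun μ ξ) ∨
      ∀ ξ, centredCharFun ν ξ = centredCharFun μ (-ξ) := by
  have := FiniteDimensional.proper ℝ E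
  have hiμ : Integrable (fun x => x) μ := .of_bound (by fun_prop) R hμ
  have hiν : Integrable (fun x => x) ν := .of_bound (by fun_prop) R hν
  have hcont (ρ : Measure E) [IsProbabilityMeasure ρ] : Continuous (centredCharFun ρ) := by
    have : IsProbabilityMeasure (ρ.map fun x => x - ∫ y, y ∂ρ) :=
      Measure.isProbabilityMeasure_map (by fun_prop)
    exact continuous_charFun
  have hcμ := hcont μ
  have hcν := hcont ν
  have hFμ := analyticOnNhd_centredCharFun_lineMap hμ
  have hFν := analyticOnNhd_centredCharFun_lineMap hν
  simp only [← sub_eq_zero (a := centredCharFun ν _)]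
  refine forall_eq_zero_or_forall_eq_zero_of_mul_eq_zero
    (fun a v => (hFν a v).sub (hFμ a v))
    (fun a v => (hFν a v).sub ?_) fun ξ => ?_
  · simpa [neg_add, add_comm] using hFμ (-a) (-v)
  rcases eq_or_ne ξ 0 with rfl | hξ
  · have hone (ρ : Measure E) [IsProbabilityMeasure ρ] : centredCharFun ρ 0 = 1 := by
      simp [centredCharFun_apply]
    simp [hone]
  · have hae : (fun θ : Metric.sphere (0 : E) 1 =>
        (centredCharFun ν (‖ξ‖ • (θ : E)) - centredCharFun μ (‖ξ‖ • (θ : E))) *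
          (centredCharFun ν (‖ξ‖ • (θ : E)) - centredCharFun μ (-(‖ξ‖ • (θ : E)))))
        =ᵐ[τ] fun _ => 0 := by
      filter_upwards [h] with θ ⟨ε, c, hε, hθ⟩
      rw [centredCharFun_smul_of_map_affine hiμ hiν hθ]
      rcases hε with rfl | rfl <;> simp
    -- Full-measure sets of directions are dense, so continuity gives every direction.
    have hall := congrFun ((Continuous.ae_eq_iff_eq _ (by fun_prop) (by fun_prop)).1 hae)
      ⟨‖ξ‖⁻¹ • ξ, by simp [norm_smul, hξ]⟩
    simpa [smul_smul, hξ] using hall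

/-- Measures are determined by their characteristic functions, so equality of the centred ones up to
the sign of the argument identifies the centred measures up to a point reflection. -/
theorem exists_eq_map_smul_add_const [FiniteDimensional ℝ E] {μ ν : Measure E}
    [IsFiniteMeasure μ] [IsFiniteMeasure ν]
    (h : (∀ ξ, centredCharFun ν ξ = centredCharFun μ ξ) ∨
      ∀ ξ, centredCharFun ν ξ = centredCharFun μ (-ξ)) :
    ∃ (ε : ℝ) (c : E), (ε = 1 ∨ ε = -1) ∧ ν = μ.map (fun x => ε • x + c) := by
  have := FiniteDimensional.complete ℝ E
  set a := ∫ y, y ∂μ with ha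
  set b := ∫ y, y ∂ν with hb
  obtain ⟨ε, hε, hεφ⟩ : ∃ ε : ℝ, (ε = 1 ∨ ε = -1) ∧
      ∀ ξ, centredCharFun ν ξ = centredCharFun μ (ε • ξ) := by
    rcases h with h | h
    · exact ⟨1, .inl rfl, by simpa using h⟩
    · exact ⟨-1, .inr rfl, by simpa using h⟩
  have key : ν.map (fun x => x - b) = (μ.map (fun x => x - a)).map (ε • ·) := by
    refine Measure.ext_of_charFun (funext fun ξ => ?_)
    rw [charFun_map_smul]
    exact hεφ ξ
  refine ⟨ε, b - ε • a, hε, ?_⟩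
  have h₁ : ν = (ν.map (fun x => x - b)).map (fun x => x + b) := by
    rw [Measure.map_map (by fun_prop) (by fun_prop)]
    simp [Function.comp_def]
  rw [h₁, key, Measure.map_map (by fun_prop) (by fun_prop),
    Measure.map_map (by fun_prop) (by fun_prop)]
  congr 1 with x
  simp only [Function.comp_apply, smul_sub]
  abel

end charFun

/-! ### Point reflections and translations -/

theorem MeasureTheory.Measure.support_map_homeomorph {X Y : Type*} [TopologicalSpace X]
    [TopologicalSpace Y] [MeasurableSpace X] [MeasurableSpace Y] [BorelSpace X] [BorelSpace Y]
    (μ : Measure X) (e : X ≃ₜ Y) : (μ.map e).support = e '' μ.support := by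
  ext y
  obtain ⟨x, rfl⟩ := e.surjective y
  rw [e.injective.mem_set_image]
  have hb := (nhds (e x)).basis_sets.comap e
  rw [← e.nhds_eq_comap x] at hb
  rw [hb.mem_measureSupport, Measure.mem_support_iff_forall]
  simp only [e.measurableEmbedding.map_apply, id]

theorem MMIsomorphic.of_homeomorph {X Y : Type*} [TopologicalSpace X] [TopologicalSpace Y]
    [MeasurableSpace X] [MeasurableSpace Y] [BorelSpace X] [BorelSpace Y]
    [HereditarilyLindelofSpace X] {dX : X → X → ℝ} {dY : Y → Y → ℝ} {μ : Measure X} {ν : Measure Y}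
    (e : X ≃ₜ Y) (he : ν = μ.map e) (hd : ∀ x x', dY (e x) (e x') = dX x x') :
    MMIsomorphic dX dY μ ν := by
  have hs : ν.support = e '' μ.support := by rw [he, μ.support_map_homeomorph]
  refine ⟨fun x => ⟨e x, hs ▸ Set.mem_image_of_mem e x.2⟩, ?_, ?_, ?_, fun x x' => hd x x'⟩
  · rintro ⟨y, hy⟩
    obtain ⟨x, hx, rfl⟩ := hs ▸ hy
    exact ⟨⟨x, hx⟩, rfl⟩
  · exact (e.measurable.comp measurable_subtype_coe).subtype_mk
  · exact (μ.map_comap_support e.measurable).trans he.symm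

theorem mainTheorem3 (p : ℕ) (μ ν : Measure (EuclideanSpace ℝ (Fin p)))
    [IsProbabilityMeasure μ] [IsProbabilityMeasure ν]
    (hμ : IsCompact μ.support) (hν : IsCompact ν.support)
    (h : ∀ᵐ θ ∂(volume : Measure (EuclideanSpace ℝ (Fin p))).toSphere,
      MMIsomorphic (fun s t : ℝ => |s - t|) (fun s t : ℝ => |s - t|)
        (μ.map (projDir θ)) (ν.map (projDir θ))) :
    MMIsomorphic distL1 distL1 μ ν := by
  obtain ⟨R, hR⟩ := (hμ.union hν).isBounded.exists_norm_le
  have hRμ : ∀ᵐ x ∂μ, ‖x‖ ≤ R := by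
    filter_upwards [Measure.support_mem_ae (μ := μ)] with x hx using hR x (.inl hx)
  have hRν : ∀ᵐ x ∂ν, ‖x‖ ≤ R := by
    filter_upwards [Measure.support_mem_ae (μ := ν)] with x hx using hR x (.inr hx)
  obtain ⟨ε, c, hε, hνμ⟩ := exists_eq_map_smul_add_const
    (centredCharFun_eq_or_eq_neg hRμ hRν (h.mono fun θ hθ => hθ.exists_map_affine))
  have hε0 : ε ≠ 0 := by rcases hε with rfl | rfl <;> norm_num
  have habs : |ε| = 1 := by rcases hε with rfl | rfl <;> norm_num
  refine .of_homeomorph ((Homeomorph.smulOfNeZero ε hε0).trans (Homeomorph.addRight c)) hνμ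
    fun x x' => ?_
  simp only [distL1]
  refine Finset.sum_congr rfl fun i _ => ?_
  simp [← mul_sub, abs_mul, habs]
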